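/- For coprime positive integers $q$ and $e$, let $\mathrm{ord}_e(q)$ denote the multiplicative order of $q$ modulo $e$, and let $m(q,e)$ denote the least positive integer $t$ for which there exist nonnegative integers $a_1,\dots,a_t$ (repetitions allowed) with $q^{a_1}+\dots+q^{a_t}\equiv 0 \pmod e$. Let $p$ be an odd prime, let $n\neq 1$ be a positive integer with $n\mid p-1$, and let $r$ be the smallest prime divisor of $n$. Then there exist positive integers $K$ and $Q$ such that $p\nmid Q$, $\mathrm{ord}_{p^K}(Q)=n$ and $m(Q,p^K)=r$. -/

import Mathlib

/-- For coprime positive integers `q` and `e`, `leastPowerSum q e` is the least positive integer `t`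
such that some sum of `t` powers of `q` (with nonnegative exponents, repetitions allowed) is
congruent to `0` modulo `e`. For `e > 0` the set below is nonempty, see `leastPowerSum_isLeast`. -/
noncomputable def leastPowerSum (q e : ℕ) : ℕ :=
  sInf {t : ℕ | 0 < t ∧ ∃ a : Fin t → ℕ, (∑ i, q ^ a i) ≡ 0 [MOD e]}

/-- For `e > 0` the defining minimum is attained, so that no default value enters. -/
theorem leastPowerSum_isLeast (q e : ℕ) (he : 0 < e) :
    IsLeast {t : ℕ | 0 < t ∧ ∃ a : Fin t → ℕ, (∑ i, q ^ a i) ≡ 0 [MOD e]}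
      (leastPowerSum q e) := by
  have hne : {t : ℕ | 0 < t ∧ ∃ a : Fin t → ℕ, (∑ i, q ^ a i) ≡ 0 [MOD e]}.Nonempty :=
    ⟨e, he, fun _ => 0, by simp [Nat.ModEq]⟩
  exact ⟨Nat.sInf_mem hne, fun _ ht => Nat.sInf_le ht⟩

section

open Finset Polynomial

/-! Since `n ∣ p - 1`, Hensel's lemma gives a primitive `n`-th root of unity `ζ` in `ℤ_[p]`; `Q` is
its residue mod `p ^ K` for large `K`. A nonempty sum of fewer than `r` powers of `ζ` is nonzero
(`IsPrimitiveRoot.sum_pow_ne_zero`): otherwise its conjugates make enough power sums vanish to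
contradict Newton's identities. Only finitely many such sums exist, so one `K` keeps them all
nonzero. -/

/-- By the Newton identities, in characteristic zero elements whose first `t` power sums vanish,
`t` being their number, have product zero. -/
theorem prod_eq_zero_of_power_sums_eq_zero {R : Type*} [CommRing R] [IsDomain R] [CharZero R]
    {t : ℕ} (ht : 0 < t) (x : Fin t → R)
    (h : ∀ k, 1 ≤ k → k ≤ t → ∑ i, x i ^ k = 0) : ∏ i, x i = 0 := by
  have newton := congrArg (MvPolynomial.aeval x) (MvPolynomial.mul_esymm_eq_sum (Fin t) R t)
  have hrhs : MvPolynomial.aeval x (∑ a ∈ antidiagonal t with a.1 < t,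
      (-1) ^ a.1 * MvPolynomial.esymm (Fin t) R a.1 * MvPolynomial.psum (Fin t) R a.2) = 0 := by
    rw [map_sum]
    refine sum_eq_zero fun a ha => ?_
    rw [mem_filter, HasAntidiagonal.mem_antidiagonal] at ha
    have hp : MvPolynomial.aeval x (MvPolynomial.psum (Fin t) R a.2) = 0 := by
      simpa [MvPolynomial.psum] using h a.2 (by omega) (by omega)
    rw [map_mul, hp, mul_zero]
  have hlhs : MvPolynomial.aeval x (MvPolynomial.esymm (Fin t) R t) = ∏ i, x i := by
    have hc : powersetCard t (univ : Finset (Fin t)) = {univ} := by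
      simpa using powersetCard_self (univ : Finset (Fin t))
    simp [MvPolynomial.esymm, hc]
  rw [map_mul, map_mul, hrhs, mul_zero, hlhs, map_natCast] at newton
  exact (mul_eq_zero.mp newton).resolve_left (by exact_mod_cast ht.ne')

/-- A vanishing nonempty sum of `n`-th roots of unity in characteristic zero has at least as many
terms as the smallest prime divisor of `n`. -/
theorem IsPrimitiveRoot.sum_pow_ne_zero {R : Type*} [CommRing R] [IsDomain R] [CharZero R]
    {ζ : R} {n : ℕ} (hn : 0 < n) (hζ : IsPrimitiveRoot ζ n) {t : ℕ} (ht : 0 < t)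
    (hlt : ∀ s : ℕ, s.Prime → s ∣ n → t < s) (a : Fin t → ℕ) : ∑ i, ζ ^ a i ≠ 0 := by
  intro h0
  have key : ∀ k, 1 ≤ k → k ≤ t → ∑ i, (ζ ^ a i) ^ k = 0 := by
    intro k hk1 hkt
    have hcop : k.Coprime n := by
      refine Nat.coprime_of_dvd fun s hs hsk hsn => ?_
      have := Nat.le_of_dvd hk1 hsk
      have := hlt s hs hsn
      omega
    have hdvd : minpoly ℤ ζ ∣ ∑ i, (X : ℤ[X]) ^ a i :=
      minpoly.isIntegrallyClosed_dvd (hζ.isIntegral hn) (by simpa using h0)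
    -- `ζ` and `ζ ^ k` are conjugate, so the relation passes from one to the other.
    rw [hζ.minpoly_eq_pow_coprime hcop] at hdvd
    obtain ⟨g, hg⟩ := hdvd
    have := congrArg (aeval (ζ ^ k)) hg
    rw [map_mul, minpoly.aeval, zero_mul, map_sum] at this
    simpa [← pow_mul, mul_comm] using this
  have := prod_eq_zero_of_power_sums_eq_zero ht _ key
  obtain ⟨i, -, hi⟩ := prod_eq_zero_iff.mp this
  exact ((hζ.isUnit hn.ne').pow (a i)).ne_zero hi

/-- The `p`-adic integers contain the `(p - 1)`-th roots of unity. -/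
theorem PadicInt.exists_isPrimitiveRoot (p : ℕ) [Fact p.Prime] {n : ℕ} (hnp : n ∣ p - 1) :
    ∃ ζ : ℤ_[p], IsPrimitiveRoot ζ n := by
  have hp : p.Prime := Fact.out
  have hn0 : n ≠ 0 := by
    rintro rfl
    have := hp.two_le
    have := zero_dvd_iff.mp hnp
    omega
  obtain ⟨u, hu⟩ := IsCyclic.exists_generator (α := (ZMod p)ˣ)
  have hu' : orderOf u = p - 1 := by
    rw [orderOf_eq_card_of_forall_mem_zpowers hu, Nat.card_eq_fintype_card, ZMod.card_units]
  have hg : IsPrimitiveRoot (u : ZMod p) (p - 1) := by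
    rw [IsPrimitiveRoot.coe_units_iff, ← hu']
    exact IsPrimitiveRoot.orderOf u
  obtain ⟨m, hm⟩ := hnp
  have hgn : IsPrimitiveRoot ((u : ZMod p) ^ m) n :=
    hg.pow (by have := hp.two_le; omega) (by rw [hm, mul_comm])
  obtain ⟨b, hb⟩ := ZMod.ringHom_surjective (PadicInt.toZMod (p := p)) ((u : ZMod p) ^ m)
  have hmem : ∀ x : ℤ_[p], x ∈ IsLocalRing.maximalIdeal ℤ_[p] ↔ PadicInt.toZMod x = 0 := fun x => by
    rw [← PadicInt.ker_toZMod, RingHom.mem_ker]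
  have hunit : ∀ x : ℤ_[p], PadicInt.toZMod x ≠ 0 → IsUnit x := fun x hx => by
    by_contra h
    exact hx ((hmem x).mp ((IsLocalRing.mem_maximalIdeal x).mpr h))
  have hnp0 : (n : ZMod p) ≠ 0 := by
    rw [Ne, ZMod.natCast_eq_zero_iff]
    intro h
    have h1 := h.trans (Dvd.intro _ hm.symm)
    have := Nat.le_of_dvd (by have := hp.two_le; omega) h1
    have := hp.two_le
    omega
  -- The root is simple mod `p`: the derivative is `n * b ^ (n - 1)`, and `p ∤ n`.
  have hderiv : PadicInt.toZMod ((derivative (X ^ n - 1 : ℤ_[p][X])).eval b) ≠ 0 := by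
    simp [derivative_X_pow, hb, hnp0]
  obtain ⟨ζ, hroot, hζb⟩ := HenselianRing.is_henselian (I := IsLocalRing.maximalIdeal ℤ_[p])
    (X ^ n - 1 : ℤ_[p][X])
    (by simpa using monic_X_pow_sub_C (1 : ℤ_[p]) hn0) b
    ((hmem _).mpr (by simp [hb, hgn.pow_eq_one]))
    ((hunit _ hderiv).map _)
  have hζg : PadicInt.toZMod ζ = (u : ZMod p) ^ m := by
    rw [← hb, ← sub_eq_zero, ← map_sub]
    exact (hmem _).mp hζb
  refine ⟨ζ, by simpa [sub_eq_zero] using hroot, fun l hl => ?_⟩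
  apply hgn.dvd_of_pow_eq_one
  rw [← hζg, ← map_pow, hl, map_one]

theorem PadicInt.eventually_toZModPow_ne_zero {p : ℕ} [Fact p.Prime] {x : ℤ_[p]} (hx : x ≠ 0) :
    ∀ᶠ K in Filter.atTop, PadicInt.toZModPow K x ≠ 0 := by
  obtain ⟨k, hk⟩ : ∃ k, PadicInt.toZModPow k x ≠ 0 := by
    by_contra! h
    exact hx (PadicInt.ext_of_toZModPow.mp fun k => by rw [h k, map_zero])
  filter_upwards [Filter.eventually_ge_atTop k] with K hK h0
  exact hk (by rw [← PadicInt.cast_toZModPow k K hK, h0, ZMod.cast_zero])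

end

theorem proposition10 (p n r : ℕ) (hp : p.Prime) (hp2 : p ≠ 2) (hn : n ≠ 1) (hnp : n ∣ p - 1)
    (hr : IsLeast {s : ℕ | s.Prime ∧ s ∣ n} r) :
    ∃ K Q : ℕ, 0 < K ∧ 0 < Q ∧ ¬ p ∣ Q ∧
      orderOf (Q : ZMod (p ^ K)) = n ∧ leastPowerSum Q (p ^ K) = r := by
  have : Fact p.Prime := ⟨hp⟩
  have hn0 : 0 < n := Nat.pos_of_dvd_of_pos hnp (by have := hp.two_le; omega)
  obtain ⟨⟨hrp, hrn⟩, hrmin⟩ := hr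
  obtain ⟨ζ, hζ⟩ := PadicInt.exists_isPrimitiveRoot p hnp
  -- Taking exponents in `Fin n` leaves finitely many conditions on `K`.
  have hsums : ∀ᶠ K in Filter.atTop, ∀ t : Fin r, ∀ a : Fin t → Fin n, 0 < (t : ℕ) →
      PadicInt.toZModPow K (∑ i, ζ ^ (a i : ℕ)) ≠ 0 := by
    refine Filter.eventually_all.mpr fun t => Filter.eventually_all.mpr fun a =>
      Filter.eventually_imp_distrib_left.mpr fun ht => ?_
    exact PadicInt.eventually_toZModPow_ne_zero
      (hζ.sum_pow_ne_zero hn0 ht (fun s hs hsn => t.2.trans_le (hrmin ⟨hs, hsn⟩)) _)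
  have hpows : ∀ᶠ K in Filter.atTop, ∀ j : Fin n, 0 < (j : ℕ) →
      PadicInt.toZModPow K (ζ ^ (j : ℕ) - 1) ≠ 0 := by
    refine Filter.eventually_all.mpr fun j => Filter.eventually_imp_distrib_left.mpr fun hj => ?_
    exact PadicInt.eventually_toZModPow_ne_zero
      (sub_ne_zero.mpr (hζ.pow_ne_one_of_pos_of_lt hj.ne' j.2))
  obtain ⟨K, ⟨hsum, hpow⟩, hK⟩ := ((hsums.and hpows).and (Filter.eventually_gt_atTop 0)).exists
  have : NeZero (p ^ K) := ⟨pow_ne_zero _ hp.ne_zero⟩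
  set Q := (PadicInt.toZModPow K ζ).val with hQdef
  have hQ : (Q : ZMod (p ^ K)) = PadicInt.toZModPow K ζ := ZMod.natCast_zmod_val _
  have hQn : (Q : ZMod (p ^ K)) ^ n = 1 := by rw [hQ, ← map_pow, hζ.pow_eq_one, map_one]
  have hpQ : ¬ p ∣ Q := by
    intro h
    have hcop := (ZMod.isUnit_iff_coprime Q (p ^ K)).mp (IsUnit.of_pow_eq_one hQn hn0.ne')
    exact hp.one_lt.ne' (Nat.eq_one_of_dvd_coprimes hcop h (dvd_pow_self p hK.ne'))
  have hmod : ∀ (t : ℕ) (a : Fin t → ℕ), (∑ i, Q ^ a i) ≡ 0 [MOD p ^ K] ↔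
      PadicInt.toZModPow K (∑ i, ζ ^ a i) = 0 := fun t a => by
    rw [← ZMod.natCast_eq_natCast_iff]
    simp [hQ]
  refine ⟨K, Q, hK, Nat.pos_of_ne_zero fun h => hpQ (h ▸ dvd_zero p), hpQ, ?_, ?_⟩
  · refine (orderOf_eq_iff hn0).mpr ⟨hQn, fun j hj hj0 h => hpow ⟨j, hj⟩ hj0 ?_⟩
    rw [map_sub, map_pow, ← hQ, h, map_one, sub_self]
  -- The multiples of `n / r` give all `r`-th roots of unity, whose sum is zero.
  · refine (leastPowerSum_isLeast Q (p ^ K) (pow_pos hp.pos K)).unique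
      ⟨⟨hrp.pos, fun i => n / r * i, (hmod _ _).mpr ?_⟩, ?_⟩
    · have hprim : IsPrimitiveRoot (ζ ^ (n / r)) r :=
        hζ.pow hn0 (Nat.div_mul_cancel hrn).symm
      have := hprim.geom_sum_eq_zero hrp.one_lt
      rw [← Fin.sum_univ_eq_sum_range (fun i => (ζ ^ (n / r)) ^ i)] at this
      simp_rw [pow_mul]
      rw [this, map_zero]
    · rintro t ⟨ht, a, ha⟩
      by_contra! htr
      refine hsum ⟨t, htr⟩ (fun i => ⟨a i % n, Nat.mod_lt _ hn0⟩) ht ?_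
      have := (hmod t a).mp ha
      rw [← this]
      congr 1
      exact Finset.sum_congr rfl fun i _ => by rw [← pow_eq_pow_mod (a i) hζ.pow_eq_one]
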